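/- For real $\nu$ and $x>0$ let $$I_\nu(x)=\sum_{n=0}^\infty\frac{(x/2)^{2n+\nu}}{n!\,\Gamma(n+\nu+1)},\qquad \mathbf{L}_\nu(x)=\sum_{n=0}^\infty\frac{(x/2)^{2n+\nu+1}}{\Gamma(n+\frac32)\,\Gamma(n+\nu+\frac32)}$$ be the modified Bessel function and the modified Struve function of the first kind. The following inequalities hold. (i) For $0<x<y$, $$\frac{x}{y}\sqrt{\frac{3(2\nu+3)+y^2}{3(2\nu+3)+x^2}}\;\frac{I_\nu(x)}{I_\nu(y)}<\frac{\mathbf{L}_\nu(x)}{\mathbf{L}_\nu(y)}<\frac{I_\nu(x)}{I_\nu(y)},$$ where the lower bound holds for $\nu\ge-\frac12$ and the upper bound holds for $\nu\ge\frac12$. (ii) Let $\nu\ge-\frac12$. Then, for $0<x<y$, $$\frac{e^{\sqrt{(\nu+1/2)^2+x^2}}}{e^{\sqrt{(\nu+1/2)^2+y^2}}}\Big(\frac{x}{y}\Big)^{\nu+1}\sqrt{\frac{3(2\nu+3)+y^2}{3(2\nu+3)+x^2}}\left(\frac{\nu+\frac12+\sqrt{(\nu+\frac12)^2+y^2}}{\nu+\frac12+\sqrt{(\nu+\frac12)^2+x^2}}\right)^{\nu+\frac12}<\frac{\mathbf{L}_\nu(x)}{\mathbf{L}_\nu(y)}$$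 and $$\frac{\mathbf{L}_\nu(x)}{\mathbf{L}_\nu(y)}<\frac{e^{\sqrt{(\nu+3/2)^2+x^2}}}{e^{\sqrt{(\nu+3/2)^2+y^2}}}\,\frac{\tanh(\frac12x)}{\tanh(\frac12y)}\Big(\frac{x}{y}\Big)^{\nu}\left(\frac{\nu+\frac32+\sqrt{(\nu+\frac32)^2+y^2}}{\nu+\frac32+\sqrt{(\nu+\frac32)^2+x^2}}\right)^{\nu+\frac32}.$$ (iii) Let $\nu\ge-\frac12$. Then, for $x>0$, $$\frac{e^{\sqrt{(\nu+3/2)^2+x^2}-\nu-3/2}}{\sqrt{\pi}\,2^{\nu-1}\Gamma(\nu+\frac32)}\,x^\nu\tanh\Big(\frac{x}{2}\Big)\left(\frac{2\nu+3}{\nu+\frac32+\sqrt{(\nu+\frac32)^2+x^2}}\right)^{\nu+\frac32}<\mathbf{L}_\nu(x)$$ and $$\mathbf{L}_\nu(x)<\frac{e^{\sqrt{(\nu+1/2)^2+x^2}-\nu-1/2}}{\sqrt{\pi}\,2^{\nu}\Gamma(\nu+\frac32)}\,x^{\nu+1}\sqrt{\frac{3(2\nu+3)}{3(2\nu+3)+x^2}}\left(\frac{2\nu+1}{\nu+\frac12+\sqrt{(\nu+\frac12)^2+x^2}}\right)^{\nu+\frac12},$$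 where, for $\nu=-\frac12$, the last factor $0^0$ is read as $1$. -/

import Mathlib

noncomputable section

/-- The modified Bessel function of the first kind `I_ν(x)` of real order `ν` at `x > 0`, given by
its power series. At a pole of the Gamma function `Real.Gamma` is `0`, so the corresponding term is
`0`, in accordance with the usual convention `1 / Γ = 0` there. -/
def modifiedBesselI (ν x : ℝ) : ℝ :=
  ∑' n : ℕ, (x / 2) ^ (2 * (n : ℝ) + ν) / ((n.factorial : ℝ) * Real.Gamma ((n : ℝ) + ν + 1))

/-- The modified Struve function of the first kind `L_ν(x)` of real order `ν` at `x > 0`, given by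
its power series, with the same convention at the poles of the Gamma function. -/
def modifiedStruveL (ν x : ℝ) : ℝ :=
  ∑' n : ℕ, (x / 2) ^ (2 * (n : ℝ) + ν + 1) /
    (Real.Gamma ((n : ℝ) + 3 / 2) * Real.Gamma ((n : ℝ) + ν + 3 / 2))

end

/-!
Each inequality compares the growth of two positive functions on `(0, ∞)`, so it follows from an
inequality between logarithmic derivatives (`div_lt_div_of_logDeriv_lt`).

Both functions are a power of `x / 2` times a series `∑ tⁿ / (Γ(n + c) Γ(n + d))` at `t = x² / 4`.
Differentiating it in two ways gives, for `r = L_{ν+1} / L_ν` and `R = I_{ν+1} / I_ν`,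
`L_ν' / L_ν = ν / x + r + β / x` and `I_ν' / I_ν = ν / x + R`, where `β` is the share of the first
term in the series of `L_ν`, and `L_ν' / L_ν = L_{ν-1} / L_ν - ν / x`, likewise for `I_ν`. Hence the
Riccati equations
`r' = 1 - r² - (2ν + 1 + β) r / x` and `R' = 1 - R² - (2ν + 1) R / x`
(`hasDerivAt_seriesRatio`).

A comparison argument starting from the limit `0` at the origin (`lt_of_deriv_lt_of_le`) then yields
`r < R` (`struveRatio_lt_besselRatio`) and, with `a_μ(x) = x / (μ + √(μ² + x²))`, the bounds
`a_{ν+3/2} < r < a_{ν+1/2}` (`amosRatio_lt_struveRatio`, `struveRatio_lt_amosRatio`). The first two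
terms of the series give `β < 3 (2ν + 3) / (3 (2ν + 3) + x²)` (`leadingShare_lt`), and comparing
coefficients with `sinh x / x` gives `x / sinh x ≤ β` (`inv_sinh_le_leadingShare`). As `a_μ` is the
logarithmic derivative of `exp √(μ² + x²) / (μ + √(μ² + x²)) ^ μ`, these are the inequalities
between logarithmic derivatives behind (i) and (ii). The bounds on `L_ν` itself follow by letting
the smaller argument tend to `0` (`mul_lt_of_div_lt_div`).
-/

open Filter Topology

/-! ### Functions determined by their logarithmic derivatives -/

/-- `f` has logarithmic derivative `u` at `x`, in the division-free form `f' = f · u`. -/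
def HasLogDerivAt (f : ℝ → ℝ) (u x : ℝ) : Prop := HasDerivAt f (f x * u) x

namespace HasLogDerivAt

variable {f g : ℝ → ℝ} {u v x : ℝ}

theorem mul (hf : HasLogDerivAt f u x) (hg : HasLogDerivAt g v x) :
    HasLogDerivAt (fun z => f z * g z) (u + v) x := by
  have h := HasDerivAt.fun_mul hf hg
  refine HasDerivAt.congr_deriv h ?_
  ring

theorem div (hf : HasLogDerivAt f u x) (hg : HasLogDerivAt g v x) (h0 : g x ≠ 0) :
    HasLogDerivAt (fun z => f z / g z) (u - v) x := by
  have h := HasDerivAt.fun_div hf hg h0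
  refine HasDerivAt.congr_deriv h ?_
  field_simp

theorem rpow_const (hf : HasLogDerivAt f u x) (h0 : 0 < f x) (p : ℝ) :
    HasLogDerivAt (fun z => f z ^ p) (p * u) x := by
  have h := HasDerivAt.rpow_const (p := p) hf (Or.inl h0.ne')
  refine HasDerivAt.congr_deriv h ?_
  rw [Real.rpow_sub_one h0.ne']
  field_simp

theorem congr_of_eq (hf : HasLogDerivAt f u x) (h : u = v) : HasLogDerivAt f v x := h ▸ hf

end HasLogDerivAt

theorem hasLogDerivAt_rpow (p : ℝ) {x : ℝ} (hx : 0 < x) :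
    HasLogDerivAt (fun z => z ^ p) (p / x) x := by
  have h := Real.hasDerivAt_rpow_const (p := p) (Or.inl hx.ne')
  refine HasDerivAt.congr_deriv h ?_
  rw [Real.rpow_sub_one hx.ne']
  field_simp

theorem hasLogDerivAt_tanh_half {x : ℝ} (hx : 0 < x) :
    HasLogDerivAt (fun z => Real.tanh (z / 2)) (1 / Real.sinh x) x := by
  have hc := Real.cosh_pos (x / 2)
  have hs : 0 < Real.sinh (x / 2) := Real.sinh_pos_iff.2 (by positivity)
  have h2 : HasDerivAt (fun z : ℝ => z / 2) (1 / 2) x := (hasDerivAt_id x).div_const 2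
  have h := h2.sinh.fun_div h2.cosh hc.ne'
  have he : Real.sinh x = 2 * Real.sinh (x / 2) * Real.cosh (x / 2) := by
    rw [← Real.sinh_two_mul]; congr 1; ring
  have hq := Real.cosh_sq (x / 2)
  simp only [HasLogDerivAt, Real.tanh_eq_sinh_div_cosh]
  refine h.congr_deriv ?_
  rw [he]
  field_simp
  linarith

theorem hasDerivAt_sqrt_add_sq (a : ℝ) {x : ℝ} (h : 0 < a + x ^ 2) :
    HasDerivAt (fun z => √(a + z ^ 2)) (x / √(a + x ^ 2)) x := by
  have h1 : HasDerivAt (fun z : ℝ => a + z ^ 2) (2 * x) x := by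
    simpa using (hasDerivAt_pow 2 x).const_add a
  refine (h1.sqrt h.ne').congr_deriv ?_
  have := Real.sqrt_pos.2 h
  field_simp

theorem hasLogDerivAt_sqrt_add_sq (a : ℝ) {x : ℝ} (h : 0 < a + x ^ 2) :
    HasLogDerivAt (fun z => √(a + z ^ 2)) (x / (a + x ^ 2)) x := by
  refine (hasDerivAt_sqrt_add_sq a h).congr_deriv ?_
  have h1 := Real.sqrt_pos.2 h
  have h2 := Real.sq_sqrt h.le
  field_simp
  rw [h2]

/-- Of two positive functions, the one with the larger logarithmic derivative grows by the larger
factor. -/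
theorem div_lt_div_of_logDeriv_lt {f g u v : ℝ → ℝ} (hf0 : ∀ x, 0 < x → 0 < f x)
    (hg0 : ∀ x, 0 < x → 0 < g x) (hf : ∀ x, 0 < x → HasLogDerivAt f (u x) x)
    (hg : ∀ x, 0 < x → HasLogDerivAt g (v x) x) (h : ∀ x, 0 < x → v x < u x) {x y : ℝ}
    (hx : 0 < x) (hxy : x < y) : f x / f y < g x / g y := by
  have hq : ∀ z, 0 < z → HasLogDerivAt (fun z => f z / g z) (u z - v z) z := fun z hz =>
    (hf z hz).div (hg z hz) (hg0 z hz).ne'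
  have hm : StrictMonoOn (fun z => f z / g z) (Set.Ioi 0) := by
    apply strictMonoOn_of_deriv_pos (convex_Ioi 0)
    · exact fun z hz => (HasDerivAt.continuousAt (hq z hz)).continuousWithinAt
    · intro z hz
      rw [interior_Ioi] at hz
      rw [HasDerivAt.deriv (hq z hz)]
      exact mul_pos (div_pos (hf0 z hz) (hg0 z hz)) (sub_pos.2 (h z hz))
  have hy := hx.trans hxy
  have := hm hx hy hxy
  have h1 := hg0 x hx
  have h2 := hg0 y hy
  have h3 := hf0 y hy
  simp only at this
  rw [div_lt_div_iff₀ h1 h2] at this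
  rw [div_lt_div_iff₀ h3 h2]
  linarith

/-- If `f` grows by a larger factor than `g`, then `f / g` exceeds its limit at `0`. -/
theorem mul_lt_of_div_lt_div {f g : ℝ → ℝ} {C : ℝ} (hf0 : ∀ x, 0 < x → 0 < f x)
    (hg0 : ∀ x, 0 < x → 0 < g x)
    (h : ∀ x y, 0 < x → x < y → f x / f y < g x / g y)
    (hlim : Tendsto (fun x => f x / g x) (𝓝[>] 0) (𝓝 C)) {x : ℝ} (hx : 0 < x) :
    C * g x < f x := by
  have key : ∀ x y, 0 < x → x < y → f x / g x < f y / g y := by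
    intro x y hx hxy
    have hy := hx.trans hxy
    have := h x y hx hxy
    rw [div_lt_div_iff₀ (hf0 y hy) (hg0 y hy)] at this
    rw [div_lt_div_iff₀ (hg0 x hx) (hg0 y hy)]
    linarith
  have h2 : C ≤ f (x / 2) / g (x / 2) := by
    refine le_of_tendsto hlim ?_
    filter_upwards [Ioo_mem_nhdsGT (show (0 : ℝ) < x / 2 by positivity)] with z hz
    exact (key z _ hz.1 hz.2).le
  have h3 := h2.trans_lt (key (x / 2) x (by positivity) (by linarith))
  rwa [lt_div_iff₀ (hg0 x hx)] at h3

/-- Comparison on `(0, ∞)`: if `f` tends to `0` at `0`, `g` is nonnegative, and `f` grows more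
slowly than `g` wherever `g ≤ f`, then `f < g`. For if `g ≤ f` held at some point, `f - g` would be
decreasing up to that point, hence bounded below by a positive constant near `0`. -/
theorem lt_of_deriv_lt_of_le {f g f' g' : ℝ → ℝ} (hf : ∀ x, 0 < x → HasDerivAt f (f' x) x)
    (hg : ∀ x, 0 < x → HasDerivAt g (g' x) x) (hg0 : ∀ x, 0 < x → 0 ≤ g x)
    (hlim : Tendsto f (𝓝[>] 0) (𝓝 0)) (h : ∀ x, 0 < x → g x ≤ f x → f' x < g' x) {x : ℝ}
    (hx : 0 < x) : f x < g x := by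
  have hd : ∀ z, 0 < z → HasDerivAt (fun z => f z - g z) (f' z - g' z) z :=
    fun z hz => (hf z hz).sub (hg z hz)
  -- A maximum of `f - g` on `[a, b]` with nonnegative value can only be at the left end.
  have key : ∀ a b, 0 < a → a < b → 0 ≤ f b - g b → f b - g b < f a - g a := by
    intro a b ha hab hb
    obtain ⟨z, hz, hmax⟩ := isCompact_Icc.exists_isMaxOn (Set.nonempty_Icc.2 hab.le)
      (f := fun z => f z - g z)
      (fun z hz => (hd z (ha.trans_le hz.1)).continuousAt.continuousWithinAt)
    have left : ∀ z ∈ Set.Icc a b, IsMaxOn (fun z => f z - g z) (Set.Icc a b) z → z = a := by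
      intro z hz hmax
      by_contra hne
      have haz : a < z := lt_of_le_of_ne hz.1 (Ne.symm hne)
      have hz0 := ha.trans haz
      have hzb : f b - g b ≤ f z - g z := hmax (Set.right_mem_Icc.2 hab.le)
      have hneg := h z hz0 (by linarith)
      have hs := hasDerivAt_iff_tendsto_slope_left_right.1 (hd z hz0)
      have : 0 ≤ f' z - g' z := by
        refine ge_of_tendsto hs.1 ?_
        filter_upwards [Ioo_mem_nhdsLT haz] with w hw
        have hwz : f w - g w ≤ f z - g z := hmax ⟨hw.1.le, hw.2.le.trans hz.2⟩
        rw [slope_def_field]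
        exact div_nonneg_of_nonpos (by linarith) (by linarith [hw.2])
      linarith
    have hza := left z hz hmax
    subst hza
    have hzb : f b - g b ≤ f z - g z := hmax (Set.right_mem_Icc.2 hab.le)
    refine lt_of_le_of_ne hzb fun he => hab.ne' (left b (Set.right_mem_Icc.2 hab.le) ?_)
    intro w hw
    have := hmax hw
    simp only [Set.mem_ofPred_eq] at this ⊢
    linarith
  by_contra! hle
  have h1 := key (x / 2) x (by positivity) (by linarith) (by linarith)
  have h2 : f (x / 2) - g (x / 2) ≤ 0 := by
    refine ge_of_tendsto hlim ?_
    filter_upwards [Ioo_mem_nhdsGT (show (0 : ℝ) < x / 2 by positivity)] with z hz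
    have := key z (x / 2) hz.1 hz.2 (by linarith)
    linarith [hg0 z hz.1]
  linarith

/-! ### The power series common to both functions -/

theorem hasDerivAt_tsum_mul_pow {a : ℕ → ℝ} (ha : ∀ ρ : ℝ, Summable fun n => |a n| * ρ ^ n)
    (t : ℝ) : Summable (fun n : ℕ => a n * (n * t ^ (n - 1))) ∧
      HasDerivAt (fun t => ∑' n, a n * t ^ n) (∑' n : ℕ, a n * (n * t ^ (n - 1))) t := by
  set ρ := |t| + 1 with hρ
  have hρ1 : 1 ≤ ρ := by have := abs_nonneg t; linarith
  have hb : ∀ (n : ℕ) (s : ℝ), s ∈ Metric.ball (0 : ℝ) ρ →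
      ‖a n * (n * s ^ (n - 1))‖ ≤ |a n| * (2 * ρ) ^ n := by
    intro n s hs
    have hs' : |s| ≤ ρ := by simpa using (mem_ball_zero_iff.1 hs).le
    rw [Real.norm_eq_abs, abs_mul, abs_mul, abs_pow, mul_pow, Nat.abs_cast]
    have h1 : (n : ℝ) ≤ 2 ^ n := by exact_mod_cast n.lt_two_pow_self.le
    have h2 : |s| ^ (n - 1) ≤ ρ ^ n :=
      (pow_le_pow_left₀ (abs_nonneg s) hs' _).trans (pow_le_pow_right₀ hρ1 (Nat.sub_le n 1))
    gcongr
  have hta : t ∈ Metric.ball (0 : ℝ) ρ := by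
    rw [mem_ball_zero_iff, Real.norm_eq_abs]; linarith
  have hsum := ha (2 * ρ)
  refine ⟨.of_norm_bounded hsum fun n => hb n t hta, ?_⟩
  refine hasDerivAt_tsum_of_isPreconnected hsum Metric.isOpen_ball
    (convex_ball (0 : ℝ) ρ).isPreconnected (fun n s _ => ?_) hb
    (Metric.mem_ball_self (by linarith)) ?_ hta
  · exact (hasDerivAt_pow n s).const_mul (a n)
  · refine .of_norm_bounded (ha 0) fun n => ?_
    simp

/-- The entire function `∑ tⁿ / (Γ(n + c) Γ(n + d))`. Up to a power of `x / 2`, its value at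
`t = x² / 4` is `I_ν(x)` for `(c, d) = (1, ν + 1)` and `L_ν(x)` for `(c, d) = (3/2, ν + 3/2)`. -/
noncomputable def gammaSeries (c d t : ℝ) : ℝ :=
  ∑' n : ℕ, 1 / (Real.Gamma (n + c) * Real.Gamma (n + d)) * t ^ n

section

variable {c d : ℝ}

theorem gammaCoeff_pos (hc : 0 < c) (hd : 0 < d) (n : ℕ) :
    0 < 1 / (Real.Gamma (n + c) * Real.Gamma (n + d)) := by
  have h1 := Real.Gamma_pos_of_pos (show 0 < n + c by positivity)
  have h2 := Real.Gamma_pos_of_pos (show 0 < n + d by positivity)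
  positivity

theorem gammaCoeff_succ (hc : 0 < c) (hd : 0 < d) (n : ℕ) :
    1 / (Real.Gamma ((n + 1 : ℕ) + c) * Real.Gamma ((n + 1 : ℕ) + d)) =
      1 / (Real.Gamma (n + c) * Real.Gamma (n + d)) * (1 / ((n + c) * (n + d))) := by
  have h1 : 0 < n + c := by positivity
  have h2 : 0 < n + d := by positivity
  have h3 := Real.Gamma_pos_of_pos h1
  have h4 := Real.Gamma_pos_of_pos h2
  push_cast
  rw [show (n : ℝ) + 1 + c = n + c + 1 by ring, show (n : ℝ) + 1 + d = n + d + 1 by ring,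
    Real.Gamma_add_one h1.ne', Real.Gamma_add_one h2.ne']
  field_simp

theorem summable_gammaCoeff (hc : 0 < c) (hd : 0 < d) (ρ : ℝ) :
    Summable fun n : ℕ => 1 / (Real.Gamma (n + c) * Real.Gamma (n + d)) * ρ ^ n := by
  rcases eq_or_ne ρ 0 with rfl | hρ
  · exact summable_of_ne_finset_zero (s := {0}) fun n hn => by
      simp only [Finset.mem_singleton] at hn
      simp [hn]
  · have hne : ∀ n : ℕ, 1 / (Real.Gamma (n + c) * Real.Gamma (n + d)) * ρ ^ n ≠ 0 := fun n =>
      mul_ne_zero (gammaCoeff_pos hc hd n).ne' (pow_ne_zero _ hρ)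
    refine summable_of_ratio_test_tendsto_lt_one zero_lt_one (.of_forall hne) ?_
    have e : ∀ n : ℕ, ‖1 / (Real.Gamma ((n + 1 : ℕ) + c) * Real.Gamma ((n + 1 : ℕ) + d)) *
        ρ ^ (n + 1)‖ / ‖1 / (Real.Gamma (n + c) * Real.Gamma (n + d)) * ρ ^ n‖ =
          |ρ| * (1 / ((n + c) * (n + d))) := by
      intro n
      have hpos : 0 < 1 / (((n : ℝ) + c) * (n + d)) := by positivity
      rw [← norm_div, gammaCoeff_succ hc hd, pow_succ]
      have := hne n
      rw [show ∀ A B P : ℝ, A * B * (P * ρ) = (A * P) * (ρ * B) by intros; ring,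
        mul_div_cancel_left₀ _ this, Real.norm_eq_abs, abs_mul, abs_of_pos hpos]
    simp only [e]
    have h1 : Tendsto (fun n : ℕ => (n : ℝ) + c) atTop atTop :=
      tendsto_atTop_add_const_right _ _ tendsto_natCast_atTop_atTop
    have h2 : Tendsto (fun n : ℕ => (n : ℝ) + d) atTop atTop :=
      tendsto_atTop_add_const_right _ _ tendsto_natCast_atTop_atTop
    have h3 := (h1.atTop_mul_atTop₀ h2).inv_tendsto_atTop.const_mul |ρ|
    simpa [Function.comp_def] using h3

theorem gammaSeries_pos (hc : 0 < c) (hd : 0 < d) {t : ℝ} (ht : 0 ≤ t) :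
    0 < gammaSeries c d t := by
  have hp : ∀ n : ℕ, 0 ≤ 1 / (Real.Gamma (n + c) * Real.Gamma (n + d)) * t ^ n := fun n =>
    mul_nonneg (gammaCoeff_pos hc hd n).le (pow_nonneg ht n)
  refine (summable_gammaCoeff hc hd t).tsum_pos hp 0 ?_
  have := gammaCoeff_pos hc hd 0
  simpa using this

theorem gammaSeries_eq_zero_add (hc : 0 < c) (hd : 0 < d) (t : ℝ) :
    gammaSeries c d t = 1 / (Real.Gamma c * Real.Gamma d) + ∑' n : ℕ,
      1 / (Real.Gamma ((n + 1 : ℕ) + c) * Real.Gamma ((n + 1 : ℕ) + d)) * t ^ (n + 1) := by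
  have := (summable_gammaCoeff hc hd t).tsum_eq_zero_add
  rw [gammaSeries, this]
  simp

theorem hasDerivAt_gammaSeries_aux (hc : 0 < c) (hd : 0 < d) (t : ℝ) :
    Summable (fun n : ℕ => 1 / (Real.Gamma (n + c) * Real.Gamma (n + d)) *
        (n * t ^ (n - 1))) ∧
      HasDerivAt (gammaSeries c d) (∑' n : ℕ, 1 / (Real.Gamma (n + c) * Real.Gamma (n + d)) *
        (n * t ^ (n - 1))) t :=
  hasDerivAt_tsum_mul_pow (fun ρ => by
    simpa only [abs_of_pos (gammaCoeff_pos hc hd _)] using summable_gammaCoeff hc hd ρ) t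

theorem natCast_mul_pow_pred (n : ℕ) (t : ℝ) : t * (n * t ^ (n - 1)) = n * t ^ n := by
  cases n with
  | zero => simp
  | succ k => rw [Nat.add_sub_cancel, pow_succ]; ring

/-- Derivative of the series from the identity `(n + d) / Γ(n + d + 1) = 1 / Γ(n + d)`. -/
theorem hasDerivAt_gammaSeries_of_lower (hc : 0 < c) (hd : 0 < d) {t : ℝ} (ht : 0 < t) :
    HasDerivAt (gammaSeries c (d + 1))
      ((gammaSeries c d t - d * gammaSeries c (d + 1) t) / t) t := by
  have hd1 : 0 < d + 1 := by linarith
  obtain ⟨hs, h⟩ := hasDerivAt_gammaSeries_aux hc hd1 t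
  refine h.congr_deriv (Eq.symm ?_)
  rw [div_eq_iff ht.ne', mul_comm _ t, ← tsum_mul_left, sub_eq_iff_eq_add, gammaSeries, gammaSeries,
    ← tsum_mul_left, ← (hs.mul_left t).tsum_add ((summable_gammaCoeff hc hd1 t).mul_left d)]
  refine tsum_congr fun n => ?_
  have h1 : 0 < n + d := by positivity
  have h2 := Real.Gamma_pos_of_pos h1
  have h3 := Real.Gamma_pos_of_pos (show 0 < n + c by positivity)
  have := natCast_mul_pow_pred n t
  rw [show t * (1 / (Real.Gamma (n + c) * Real.Gamma (n + (d + 1))) * (n * t ^ (n - 1))) =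
    1 / (Real.Gamma (n + c) * Real.Gamma (n + (d + 1))) * (t * (n * t ^ (n - 1))) by ring, this,
    ← add_assoc, Real.Gamma_add_one h1.ne']
  field_simp

/-- Derivative of the series from the identity `(n + c) / Γ(n + c + 1) = 1 / Γ(n + c)`, with an
inhomogeneous term coming from the constant coefficient. -/
theorem hasDerivAt_gammaSeries (hc : 0 < c) (hd : 0 < d) {t : ℝ} (ht : 0 < t) :
    HasDerivAt (gammaSeries c d) (gammaSeries c (d + 1) t +
      (c - 1) * (1 / (Real.Gamma c * Real.Gamma d) - gammaSeries c d t) / t) t := by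
  have hd1 : 0 < d + 1 := by linarith
  obtain ⟨hs, h⟩ := hasDerivAt_gammaSeries_aux hc hd t
  refine h.congr_deriv (Eq.symm ?_)
  have hs1 := (summable_nat_add_iff 1).2 (summable_gammaCoeff hc hd t)
  rw [gammaSeries_eq_zero_add hc hd, hs.tsum_eq_zero_add]
  have : (c - 1) * (1 / (Real.Gamma c * Real.Gamma d) - (1 / (Real.Gamma c * Real.Gamma d) +
      ∑' n : ℕ, 1 / (Real.Gamma ((n + 1 : ℕ) + c) * Real.Gamma ((n + 1 : ℕ) + d)) * t ^ (n + 1)))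
        / t = -((c - 1) / t * ∑' n : ℕ,
      1 / (Real.Gamma ((n + 1 : ℕ) + c) * Real.Gamma ((n + 1 : ℕ) + d)) * t ^ (n + 1)) := by
    ring
  rw [this, ← sub_eq_add_neg, sub_eq_iff_eq_add, ← tsum_mul_left, Nat.cast_zero, zero_mul,
    mul_zero, zero_add,
    ← ((summable_nat_add_iff 1).2 hs).tsum_add (hs1.mul_left _), gammaSeries]
  refine tsum_congr fun n => ?_
  have h1 : 0 < n + c := by positivity
  have h2 : 0 < n + (d + 1) := by positivity
  have h3 := Real.Gamma_pos_of_pos h1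
  have h4 := Real.Gamma_pos_of_pos h2
  push_cast
  rw [show (n : ℝ) + 1 + c = n + c + 1 by ring, show (n : ℝ) + 1 + d = n + (d + 1) by ring,
    Real.Gamma_add_one h1.ne', pow_succ]
  field_simp
  ring

theorem continuous_gammaSeries (hc : 0 < c) (hd : 0 < d) : Continuous (gammaSeries c d) :=
  continuous_iff_continuousAt.2 fun t => (hasDerivAt_gammaSeries_aux hc hd t).2.continuousAt

/-- The first two terms of the series bound it from below. -/
theorem lt_gammaSeries (hc : 0 < c) (hd : 0 < d) {t : ℝ} (ht : 0 < t) :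
    1 / (Real.Gamma c * Real.Gamma d) * (1 + t / (c * d)) < gammaSeries c d t := by
  have hp : ∀ n : ℕ, 0 < 1 / (Real.Gamma (n + c) * Real.Gamma (n + d)) * t ^ n := fun n =>
    mul_pos (gammaCoeff_pos hc hd n) (pow_pos ht n)
  have hs := summable_gammaCoeff hc hd t
  have h3 := hs.sum_le_tsum (Finset.range 3) fun n _ => (hp n).le
  rw [Finset.sum_range_succ, Finset.sum_range_succ, Finset.sum_range_one] at h3
  have h1 := gammaCoeff_succ hc hd 0
  rw [zero_add] at h1
  have h2 := hp 2
  rw [h1] at h3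
  simp only [Nat.cast_zero, zero_add, pow_zero, pow_one, mul_one] at h3
  refine lt_of_lt_of_le (lt_add_of_pos_right _ h2) (le_trans (le_of_eq ?_) h3)
  ring

/-- Coefficientwise comparison with the series of `sinh x / x`, which is the case `d = 1`. -/
theorem gammaSeries_le_sinh (hd : 1 ≤ d) {x : ℝ} (hx : 0 < x) :
    gammaSeries (3 / 2) d (x ^ 2 / 4) ≤
      1 / (Real.Gamma (3 / 2) * Real.Gamma d) * (Real.sinh x / x) := by
  have hd0 : 0 < d := by linarith
  have hc : (0 : ℝ) < 3 / 2 := by norm_num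
  have hcoef : ∀ n : ℕ, 1 / (Real.Gamma (n + 3 / 2) * Real.Gamma (n + d)) ≤
      1 / (Real.Gamma (3 / 2) * Real.Gamma d) * (4 ^ n / ((2 * n + 1).factorial : ℝ)) := by
    intro n
    induction n with
    | zero => simp
    | succ n ih =>
      rw [gammaCoeff_succ hc hd0]
      have h1 : 0 < 1 / (((n : ℝ) + 3 / 2) * (n + d)) := by positivity
      have h2 : 1 / (((n : ℝ) + 3 / 2) * (n + d)) ≤ 4 / ((2 * n + 2) * (2 * n + 3)) := by
        rw [div_le_div_iff₀ (by positivity) (by positivity)]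
        have : (n : ℝ) + 1 ≤ n + d := by linarith
        nlinarith [mul_le_mul_of_nonneg_left this (show (0 : ℝ) ≤ n + 3 / 2 by positivity)]
      have h0 := gammaCoeff_pos hc hd0 0
      simp only [Nat.cast_zero, zero_add] at h0
      refine (mul_le_mul ih h2 h1.le (by positivity)).trans (le_of_eq ?_)
      have : (2 * (n + 1) + 1).factorial = (2 * n + 3) * ((2 * n + 2) * (2 * n + 1).factorial) := by
        rw [show 2 * (n + 1) + 1 = 2 * n + 1 + 1 + 1 by ring, Nat.factorial_succ,
          Nat.factorial_succ]
      rw [this]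
      push_cast
      field_simp
      ring
  have hsinh : HasSum (fun n : ℕ => 1 / (Real.Gamma (3 / 2) * Real.Gamma d) *
      (4 ^ n / ((2 * n + 1).factorial : ℝ)) * (x ^ 2 / 4) ^ n)
      (1 / (Real.Gamma (3 / 2) * Real.Gamma d) * (Real.sinh x / x)) := by
    have := ((Real.hasSum_sinh x).div_const x).mul_left (1 / (Real.Gamma (3 / 2) * Real.Gamma d))
    refine Eq.subst (motive := fun f => HasSum f _) (funext fun n => ?_) this
    rw [div_pow, pow_succ x, pow_mul]
    field_simp
  exact (summable_gammaCoeff hc hd0 _).tsum_le_tsum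
    (fun n => mul_le_mul_of_nonneg_right (hcoef n) (by positivity)) hsinh.summable
    |>.trans_eq hsinh.tsum_eq

end

/-! ### Ratios of consecutive series and the Riccati equation -/

/-- The ratio `I_{ν+1}(x) / I_ν(x)` for `(c, d) = (1, ν + 1)`, and `L_{ν+1}(x) / L_ν(x)` for
`(c, d) = (3/2, ν + 3/2)`. -/
noncomputable def seriesRatio (c d x : ℝ) : ℝ :=
  x / 2 * gammaSeries c (d + 1) (x ^ 2 / 4) / gammaSeries c d (x ^ 2 / 4)

/-- `2 (c - 1)` times the share of the constant term in the series: the inhomogeneous term in the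
logarithmic derivative. It vanishes for the Bessel function. -/
noncomputable def leadingShare (c d x : ℝ) : ℝ :=
  2 * (c - 1) / (Real.Gamma c * Real.Gamma d * gammaSeries c d (x ^ 2 / 4))

section

variable {c d x : ℝ}

theorem seriesRatio_pos (hc : 0 < c) (hd : 0 < d) (hx : 0 < x) : 0 < seriesRatio c d x := by
  have h1 := gammaSeries_pos hc hd (show 0 ≤ x ^ 2 / 4 by positivity)
  have h2 := gammaSeries_pos hc (show 0 < d + 1 by linarith) (show 0 ≤ x ^ 2 / 4 by positivity)
  unfold seriesRatio
  positivity

theorem tendsto_seriesRatio (hc : 0 < c) (hd : 0 < d) :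
    Tendsto (seriesRatio c d) (𝓝[>] 0) (𝓝 0) := by
  have hd1 : 0 < d + 1 := by linarith
  have hc1 := continuous_gammaSeries hc hd
  have hc2 := continuous_gammaSeries hc hd1
  have : ContinuousAt (seriesRatio c d) 0 := by
    unfold seriesRatio
    refine ContinuousAt.div (by fun_prop) (by fun_prop) ?_
    exact (gammaSeries_pos hc hd (by norm_num)).ne'
  have h := this.tendsto.mono_left (nhdsWithin_le_nhds (s := Set.Ioi 0))
  simpa [seriesRatio] using h

theorem hasDerivAt_sq_div_four (x : ℝ) : HasDerivAt (fun z : ℝ => z ^ 2 / 4) (x / 2) x := by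
  refine ((hasDerivAt_pow 2 x).div_const 4).congr_deriv ?_
  push_cast
  ring

theorem hasLogDerivAt_half (hx : 0 < x) : HasLogDerivAt (fun z : ℝ => z / 2) (1 / x) x := by
  refine ((hasDerivAt_id x).div_const 2).congr_deriv ?_
  field_simp

theorem hasLogDerivAt_gammaSeries (hc : 0 < c) (hd : 0 < d) (hx : 0 < x) :
    HasLogDerivAt (fun z => gammaSeries c d (z ^ 2 / 4))
      (seriesRatio c d x + leadingShare c d x / x - 2 * (c - 1) / x) x := by
  have h := (hasDerivAt_gammaSeries hc hd (show 0 < x ^ 2 / 4 by positivity)).comp x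
    (hasDerivAt_sq_div_four x)
  refine HasDerivAt.congr_deriv h ?_
  have h1 := gammaSeries_pos hc hd (show 0 ≤ x ^ 2 / 4 by positivity)
  have h2 := Real.Gamma_pos_of_pos hc
  have h3 := Real.Gamma_pos_of_pos hd
  simp only [seriesRatio, leadingShare]
  field_simp
  ring

theorem hasLogDerivAt_gammaSeries_of_lower (hc : 0 < c) (hd : 0 < d) (hx : 0 < x) :
    HasLogDerivAt (fun z => gammaSeries c (d + 1) (z ^ 2 / 4))
      (1 / seriesRatio c d x - 2 * d / x) x := by
  have h := (hasDerivAt_gammaSeries_of_lower hc hd (show 0 < x ^ 2 / 4 by positivity)).comp x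
    (hasDerivAt_sq_div_four x)
  refine HasDerivAt.congr_deriv h ?_
  have h1 := gammaSeries_pos hc hd (show 0 ≤ x ^ 2 / 4 by positivity)
  have h2 := gammaSeries_pos hc (show 0 < d + 1 by linarith) (show 0 ≤ x ^ 2 / 4 by positivity)
  simp only [seriesRatio]
  field_simp
  ring

/-- The Riccati equation satisfied by the ratio of consecutive series. -/
theorem hasDerivAt_seriesRatio (hc : 0 < c) (hd : 0 < d) (hx : 0 < x) :
    HasDerivAt (seriesRatio c d) (1 - seriesRatio c d x ^ 2 -
      (2 * (d - c) + 1 + leadingShare c d x) * seriesRatio c d x / x) x := by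
  have h1 := gammaSeries_pos hc hd (show 0 ≤ x ^ 2 / 4 by positivity)
  have h := ((hasLogDerivAt_half hx).mul (hasLogDerivAt_gammaSeries_of_lower hc hd hx)).div
    (hasLogDerivAt_gammaSeries hc hd hx) h1.ne'
  refine HasDerivAt.congr_deriv h ?_
  have hr := seriesRatio_pos hc hd hx
  change seriesRatio c d x * _ = _
  field_simp
  ring

theorem leadingShare_pos (hc : 1 < c) (hd : 0 < d) : 0 < leadingShare c d x := by
  have hc0 : 0 < c := by linarith
  have h1 := gammaSeries_pos hc0 hd (show 0 ≤ x ^ 2 / 4 by positivity)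
  have h2 := Real.Gamma_pos_of_pos hc0
  have h3 := Real.Gamma_pos_of_pos hd
  have h4 : 0 < c - 1 := by linarith
  unfold leadingShare
  positivity

/-- Bound from the first two terms of the series. -/
theorem leadingShare_lt (hc : 1 < c) (hd : 0 < d) (hx : 0 < x) :
    leadingShare c d x < 2 * (c - 1) * (4 * c * d / (4 * c * d + x ^ 2)) := by
  have hc0 : 0 < c := by linarith
  have h1 := lt_gammaSeries hc0 hd (show 0 < x ^ 2 / 4 by positivity)
  have h0 := gammaSeries_pos hc0 hd (show 0 ≤ x ^ 2 / 4 by positivity)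
  have h2 := Real.Gamma_pos_of_pos hc0
  have h3 := Real.Gamma_pos_of_pos hd
  have h4 : 0 < c - 1 := by linarith
  unfold leadingShare
  rw [← mul_div_assoc, div_lt_div_iff₀ (by positivity) (by positivity)]
  rw [one_div_mul_eq_div, div_lt_iff₀ (by positivity)] at h1
  have h5 : 4 * c * d + x ^ 2 = 4 * c * d * (1 + x ^ 2 / 4 / (c * d)) := by field_simp
  rw [h5]
  have h6 : 0 < 2 * (c - 1) * (4 * c * d) := by positivity
  nlinarith [mul_lt_mul_of_pos_left h1 h6]

/-- Equality holds for `d = 1`, where `L_{-1/2}(x)` is a multiple of `sinh x / √x`. -/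
theorem inv_sinh_le_leadingShare (hd : 1 ≤ d) (hx : 0 < x) :
    1 / Real.sinh x ≤ leadingShare (3 / 2) d x / x := by
  have hd0 : 0 < d := by linarith
  have hc0 : (0 : ℝ) < 3 / 2 := by norm_num
  have h1 := gammaSeries_le_sinh hd hx
  have h0 := gammaSeries_pos hc0 hd0 (show 0 ≤ x ^ 2 / 4 by positivity)
  have h2 := Real.Gamma_pos_of_pos hc0
  have h3 := Real.Gamma_pos_of_pos hd0
  have h4 := Real.sinh_pos_iff.2 hx
  unfold leadingShare
  rw [div_div, div_le_div_iff₀ h4 (by positivity)]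
  rw [one_div_mul_eq_div, le_div_iff₀ (by positivity), le_div_iff₀ hx] at h1
  linarith

end

/-! ### Amos-type bounds -/

/-- The positive root `x / (μ + √(μ² + x²))` of `r² + 2 μ r / x = 1`. -/
noncomputable def amosRatio (μ x : ℝ) : ℝ := x / (μ + √(μ ^ 2 + x ^ 2))

/-- A function with logarithmic derivative `amosRatio μ`. -/
noncomputable def amosFactor (μ x : ℝ) : ℝ :=
  Real.exp √(μ ^ 2 + x ^ 2) / (μ + √(μ ^ 2 + x ^ 2)) ^ μ

section

variable {μ ν x : ℝ}

theorem amosFactor_pos (hμ : 0 ≤ μ) (hx : 0 < x) : 0 < amosFactor μ x := by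
  have := Real.sqrt_pos.2 (show 0 < μ ^ 2 + x ^ 2 by positivity)
  unfold amosFactor
  positivity

theorem amosRatio_pos (hμ : 0 ≤ μ) (hx : 0 < x) : 0 < amosRatio μ x := by
  have := Real.sqrt_pos.2 (show 0 < μ ^ 2 + x ^ 2 by positivity)
  unfold amosRatio
  positivity

theorem hasLogDerivAt_amosFactor (hμ : 0 ≤ μ) (hx : 0 < x) :
    HasLogDerivAt (amosFactor μ) (amosRatio μ x) x := by
  have h0 : 0 < μ ^ 2 + x ^ 2 := by positivity
  have hw := Real.sqrt_pos.2 h0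
  have h1 := hasDerivAt_sqrt_add_sq (μ ^ 2) h0
  have h2 : HasLogDerivAt (fun z => μ + √(μ ^ 2 + z ^ 2))
      (x / √(μ ^ 2 + x ^ 2) / (μ + √(μ ^ 2 + x ^ 2))) x := by
    refine (h1.const_add μ).congr_deriv ?_
    field_simp
  have h3 : HasLogDerivAt (fun z => Real.exp √(μ ^ 2 + z ^ 2)) (x / √(μ ^ 2 + x ^ 2)) x := h1.exp
  have hpos : 0 < μ + √(μ ^ 2 + x ^ 2) := by positivity
  refine (h3.div (h2.rpow_const hpos μ) (Real.rpow_pos_of_pos hpos μ).ne').congr_of_eq ?_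
  unfold amosRatio
  field_simp
  ring

theorem amosRatio_quadratic (hμ : 0 ≤ μ) (hx : 0 < x) :
    1 - amosRatio μ x ^ 2 = 2 * μ * amosRatio μ x / x := by
  have h0 : 0 < μ ^ 2 + x ^ 2 := by positivity
  have hw := Real.sqrt_pos.2 h0
  have hs := Real.sq_sqrt h0.le
  unfold amosRatio
  field_simp
  nlinarith

theorem hasDerivAt_amosRatio (hμ : 0 ≤ μ) (hx : 0 < x) :
    HasDerivAt (amosRatio μ) (amosRatio μ x / x * (μ / √(μ ^ 2 + x ^ 2))) x := by
  have h0 : 0 < μ ^ 2 + x ^ 2 := by positivity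
  have hw := Real.sqrt_pos.2 h0
  have hs := Real.sq_sqrt h0.le
  refine ((hasDerivAt_id x).div ((hasDerivAt_sqrt_add_sq (μ ^ 2) h0).const_add μ)
    (by positivity)).congr_deriv ?_
  unfold amosRatio
  simp only [id]
  field_simp
  nlinarith

theorem tendsto_amosRatio (hμ : 0 < μ) : Tendsto (amosRatio μ) (𝓝[>] 0) (𝓝 0) := by
  have : ContinuousAt (amosRatio μ) 0 := by
    unfold amosRatio
    refine ContinuousAt.div (by fun_prop) (by fun_prop) ?_
    positivity
  have h := this.tendsto.mono_left (nhdsWithin_le_nhds (s := Set.Ioi 0))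
  simpa [amosRatio] using h

/-- `L_{ν+1} / L_ν < I_{ν+1} / I_ν`: the two ratios satisfy the same Riccati equation up to the
inhomogeneous term, which slows the growth of the Struve ratio. -/
theorem struveRatio_lt_besselRatio (hν : -(1 / 2) ≤ ν) (hx : 0 < x) :
    seriesRatio (3 / 2) (ν + 3 / 2) x < seriesRatio 1 (ν + 1) x := by
  have hd : 0 < ν + 3 / 2 := by linarith
  have hd1 : 0 < ν + 1 := by linarith
  have hc : (0 : ℝ) < 3 / 2 := by norm_num
  refine lt_of_deriv_lt_of_le (fun z hz => hasDerivAt_seriesRatio hc hd hz)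
    (fun z hz => hasDerivAt_seriesRatio one_pos hd1 hz)
    (fun z hz => (seriesRatio_pos one_pos hd1 hz).le) (tendsto_seriesRatio hc hd) ?_ hx
  intro z hz hle
  have hr := seriesRatio_pos hc hd hz
  have hR := seriesRatio_pos one_pos hd1 hz
  have hb := leadingShare_pos (x := z) (show (1 : ℝ) < 3 / 2 by norm_num) hd
  have h0 : leadingShare 1 (ν + 1) z = 0 := by simp [leadingShare]
  rw [h0]
  set r := seriesRatio (3 / 2) (ν + 3 / 2) z
  set R := seriesRatio 1 (ν + 1) z
  set b := leadingShare (3 / 2) (ν + 3 / 2) z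
  have h1 : R ^ 2 ≤ r ^ 2 := pow_le_pow_left₀ hR.le hle 2
  have h2 : (2 * (ν + 1 - 1) + 1 + 0) * R / z <
      (2 * (ν + 3 / 2 - 3 / 2) + 1 + b) * r / z := by
    refine div_lt_div_of_pos_right ?_ hz
    have := mul_le_mul_of_nonneg_left hle (show 0 ≤ 2 * ν + 1 by linarith)
    nlinarith [mul_pos hb hr]
  linarith

/-- `L_{ν+1} / L_ν < x / (ν + 1/2 + √((ν + 1/2)² + x²))`: where the ratio is at least this bound, the
Riccati equation makes it decrease, while the bound is nondecreasing. -/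
theorem struveRatio_lt_amosRatio (hν : -(1 / 2) ≤ ν) (hx : 0 < x) :
    seriesRatio (3 / 2) (ν + 3 / 2) x < amosRatio (ν + 1 / 2) x := by
  have hd : 0 < ν + 3 / 2 := by linarith
  have hμ : 0 ≤ ν + 1 / 2 := by linarith
  have hc : (0 : ℝ) < 3 / 2 := by norm_num
  refine lt_of_deriv_lt_of_le (fun z hz => hasDerivAt_seriesRatio hc hd hz)
    (fun z hz => hasDerivAt_amosRatio hμ hz)
    (fun z hz => (amosRatio_pos hμ hz).le) (tendsto_seriesRatio hc hd) ?_ hx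
  intro z hz hle
  have hr := seriesRatio_pos hc hd hz
  have hR := amosRatio_pos hμ hz
  have hb := leadingShare_pos (x := z) (show (1 : ℝ) < 3 / 2 by norm_num) hd
  have hq := amosRatio_quadratic hμ hz
  have h3 : 0 ≤ amosRatio (ν + 1 / 2) z / z * ((ν + 1 / 2) / √((ν + 1 / 2) ^ 2 + z ^ 2)) := by
    positivity
  refine lt_of_lt_of_le ?_ h3
  set r := seriesRatio (3 / 2) (ν + 3 / 2) z
  set R := amosRatio (ν + 1 / 2) z
  set b := leadingShare (3 / 2) (ν + 3 / 2) z
  have h1 : R ^ 2 ≤ r ^ 2 := pow_le_pow_left₀ hR.le hle 2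
  have h2 : 2 * (ν + 1 / 2) * R / z < (2 * (ν + 3 / 2 - 3 / 2) + 1 + b) * r / z := by
    refine div_lt_div_of_pos_right ?_ hz
    have := mul_le_mul_of_nonneg_left hle (show 0 ≤ 2 * ν + 1 by linarith)
    nlinarith [mul_pos hb hr]
  linarith

/-- `x / (ν + 3/2 + √((ν + 3/2)² + x²)) < L_{ν+1} / L_ν`. Since the leading share is below `1`, the
Struve ratio grows faster than a solution of `r' = 1 - r² - (2ν + 2) r / x`, whereas the bound
grows more slowly, its quotient by `x` being nonincreasing. -/
theorem amosRatio_lt_struveRatio (hν : -(1 / 2) ≤ ν) (hx : 0 < x) :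
    amosRatio (ν + 3 / 2) x < seriesRatio (3 / 2) (ν + 3 / 2) x := by
  have hd : 0 < ν + 3 / 2 := by linarith
  have hc : (0 : ℝ) < 3 / 2 := by norm_num
  refine lt_of_deriv_lt_of_le (fun z hz => hasDerivAt_amosRatio hd.le hz)
    (fun z hz => hasDerivAt_seriesRatio hc hd hz)
    (fun z hz => (seriesRatio_pos hc hd hz).le) (tendsto_amosRatio hd) ?_ hx
  intro z hz hle
  have hr := seriesRatio_pos hc hd hz
  have hR := amosRatio_pos hd.le hz
  have hb := leadingShare_lt (show (1 : ℝ) < 3 / 2 by norm_num) hd hz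
  have hq := amosRatio_quadratic hd.le hz
  have h0 : 0 < (ν + 3 / 2) ^ 2 + z ^ 2 := by positivity
  have h4 : (ν + 3 / 2) / √((ν + 3 / 2) ^ 2 + z ^ 2) ≤ 1 := by
    rw [div_le_one (Real.sqrt_pos.2 h0)]
    exact Real.le_sqrt_of_sq_le (by nlinarith)
  have h3 := mul_le_mul_of_nonneg_left h4 (div_pos hR hz).le
  have hb1 : leadingShare (3 / 2) (ν + 3 / 2) z < 1 := by
    refine hb.trans_le ?_
    rw [show (2 : ℝ) * (3 / 2 - 1) = 1 by norm_num, one_mul, div_le_one (by positivity)]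
    nlinarith
  refine lt_of_le_of_lt h3 ?_
  set r := seriesRatio (3 / 2) (ν + 3 / 2) z
  set R := amosRatio (ν + 3 / 2) z
  set b := leadingShare (3 / 2) (ν + 3 / 2) z
  have h1 : r ^ 2 ≤ R ^ 2 := pow_le_pow_left₀ hr.le hle 2
  have h2 : (2 * (ν + 3 / 2 - 3 / 2) + 1 + b) * r / z < (2 * (ν + 3 / 2) - 1) * R / z := by
    refine div_lt_div_of_pos_right ?_ hz
    have := mul_le_mul_of_nonneg_left hle (show 0 ≤ 2 * ν + 2 by linarith)
    nlinarith [mul_lt_mul_of_pos_right hb1 hr]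
  have h5 : (2 * (ν + 3 / 2) - 1) * R / z = 2 * (ν + 3 / 2) * R / z - R / z * 1 := by ring
  linarith

end

/-! ### Logarithmic derivatives of the Bessel and Struve functions -/

section

variable {ν x : ℝ}

theorem half_rpow_two_mul_add (hx : 0 < x) (n : ℕ) (p : ℝ) :
    (x / 2) ^ (2 * (n : ℝ) + p) = (x / 2) ^ p * (x ^ 2 / 4) ^ n := by
  have h : (x / 2) ^ (2 * (n : ℝ)) = (x ^ 2 / 4) ^ n := by
    rw [show 2 * (n : ℝ) = ((2 * n : ℕ) : ℝ) by push_cast; ring, Real.rpow_natCast, pow_mul]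
    congr 1
    ring
  rw [Real.rpow_add (by positivity), h, mul_comm]

theorem modifiedBesselI_eq (hx : 0 < x) :
    modifiedBesselI ν x = (x / 2) ^ ν * gammaSeries 1 (ν + 1) (x ^ 2 / 4) := by
  rw [modifiedBesselI, gammaSeries, ← tsum_mul_left]
  refine tsum_congr fun n => ?_
  rw [half_rpow_two_mul_add hx, Real.Gamma_nat_eq_factorial, add_assoc]
  ring

theorem modifiedStruveL_eq (hx : 0 < x) :
    modifiedStruveL ν x = (x / 2) ^ (ν + 1) * gammaSeries (3 / 2) (ν + 3 / 2) (x ^ 2 / 4) := by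
  rw [modifiedStruveL, gammaSeries, ← tsum_mul_left]
  refine tsum_congr fun n => ?_
  rw [add_assoc (2 * (n : ℝ)), half_rpow_two_mul_add hx, add_assoc (n : ℝ)]
  ring

theorem modifiedBesselI_pos (hν : -1 < ν) (hx : 0 < x) : 0 < modifiedBesselI ν x := by
  rw [modifiedBesselI_eq hx]
  exact mul_pos (by positivity) (gammaSeries_pos one_pos (by linarith) (by positivity))

theorem modifiedStruveL_pos (hν : -(3 / 2) < ν) (hx : 0 < x) : 0 < modifiedStruveL ν x := by
  rw [modifiedStruveL_eq hx]
  exact mul_pos (by positivity) (gammaSeries_pos (by norm_num) (by linarith) (by positivity))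

theorem hasLogDerivAt_half_rpow (p : ℝ) (hx : 0 < x) :
    HasLogDerivAt (fun z : ℝ => (z / 2) ^ p) (p / x) x := by
  exact ((hasLogDerivAt_half hx).rpow_const (by positivity) p).congr_of_eq (by ring)

theorem HasLogDerivAt.congr_of_pos {f g : ℝ → ℝ} {u : ℝ} (hf : HasLogDerivAt f u x) (hx : 0 < x)
    (h : ∀ z, 0 < z → g z = f z) : HasLogDerivAt g u x := by
  unfold HasLogDerivAt
  rw [h x hx]
  refine HasDerivAt.congr_of_eventuallyEq hf ?_
  filter_upwards [lt_mem_nhds hx] with z hz using h z hz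

theorem hasLogDerivAt_modifiedBesselI (hν : -1 < ν) (hx : 0 < x) :
    HasLogDerivAt (modifiedBesselI ν) (ν / x + seriesRatio 1 (ν + 1) x) x := by
  refine (((hasLogDerivAt_half_rpow ν hx).mul (hasLogDerivAt_gammaSeries one_pos
    (show 0 < ν + 1 by linarith) hx)).congr_of_pos hx fun z hz => modifiedBesselI_eq hz).congr_of_eq
      ?_
  simp [leadingShare]

theorem hasLogDerivAt_modifiedStruveL (hν : -(3 / 2) < ν) (hx : 0 < x) :
    HasLogDerivAt (modifiedStruveL ν) (ν / x + seriesRatio (3 / 2) (ν + 3 / 2) x +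
      leadingShare (3 / 2) (ν + 3 / 2) x / x) x := by
  refine (((hasLogDerivAt_half_rpow (ν + 1) hx).mul (hasLogDerivAt_gammaSeries (c := 3 / 2)
    (by norm_num) (show 0 < ν + 3 / 2 by linarith) hx)).congr_of_pos hx
      fun z hz => modifiedStruveL_eq hz).congr_of_eq ?_
  ring

/-- `I_ν' / I_ν = I_{ν-1} / I_ν - ν / x`. -/
theorem hasLogDerivAt_modifiedBesselI_of_lower (hν : 0 < ν) (hx : 0 < x) :
    HasLogDerivAt (modifiedBesselI ν) (1 / seriesRatio 1 ν x - ν / x) x := by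
  refine (((hasLogDerivAt_half_rpow ν hx).mul (hasLogDerivAt_gammaSeries_of_lower one_pos
    hν hx)).congr_of_pos hx fun z hz => modifiedBesselI_eq hz).congr_of_eq ?_
  ring

/-- `L_ν' / L_ν = L_{ν-1} / L_ν - ν / x`. -/
theorem hasLogDerivAt_modifiedStruveL_of_lower (hν : -(1 / 2) < ν) (hx : 0 < x) :
    HasLogDerivAt (modifiedStruveL ν) (1 / seriesRatio (3 / 2) (ν + 1 / 2) x - ν / x) x := by
  refine (((hasLogDerivAt_half_rpow (ν + 1) hx).mul (hasLogDerivAt_gammaSeries_of_lower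
    (c := 3 / 2) (by norm_num) (show 0 < ν + 1 / 2 by linarith) hx)).congr_of_pos hx
      fun z hz => ?_).congr_of_eq ?_
  · rw [modifiedStruveL_eq hz, show ν + 1 / 2 + 1 = ν + 3 / 2 by ring]
  · ring

/-- The bound from the first two terms of the series of `L_ν`, written with the logarithmic
derivatives of `x` and `√(3 (2ν + 3) + x²)`. -/
theorem leadingShare_struve_lt (hν : -(3 / 2) < ν) (hx : 0 < x) :
    leadingShare (3 / 2) (ν + 3 / 2) x / x < 1 / x - x / (3 * (2 * ν + 3) + x ^ 2) := by
  have hA : 0 < 2 * ν + 3 := by linarith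
  have h := leadingShare_lt (show (1 : ℝ) < 3 / 2 by norm_num) (show 0 < ν + 3 / 2 by linarith) hx
  rw [show (2 : ℝ) * (3 / 2 - 1) = 1 by norm_num, one_mul,
    show 4 * (3 / 2) * (ν + 3 / 2) = 3 * (2 * ν + 3) by ring] at h
  have e : 1 / x - x / (3 * (2 * ν + 3) + x ^ 2) =
      3 * (2 * ν + 3) / (3 * (2 * ν + 3) + x ^ 2) / x := by
    field_simp
    ring
  rw [e]
  exact div_lt_div_of_pos_right h hx

/-! ### Comparison functions for the Struve function -/

/-- The function bounding the growth of `L_ν` from above. -/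
noncomputable def struveMajorant (ν x : ℝ) : ℝ :=
  amosFactor (ν + 1 / 2) x * x ^ (ν + 1) / √(3 * (2 * ν + 3) + x ^ 2)

/-- The function bounding the growth of `L_ν` from below. -/
noncomputable def struveMinorant (ν x : ℝ) : ℝ :=
  amosFactor (ν + 3 / 2) x * Real.tanh (x / 2) * x ^ ν

theorem tanh_half_pos (hx : 0 < x) : 0 < Real.tanh (x / 2) := by
  rw [Real.tanh_eq_sinh_div_cosh]
  exact div_pos (Real.sinh_pos_iff.2 (by positivity)) (Real.cosh_pos _)

theorem struveMajorant_pos (hν : -(1 / 2) ≤ ν) (hx : 0 < x) : 0 < struveMajorant ν x := by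
  have h1 := amosFactor_pos (show 0 ≤ ν + 1 / 2 by linarith) hx
  have hA : 0 < 2 * ν + 3 := by linarith
  unfold struveMajorant
  positivity

theorem struveMinorant_pos (hν : -(1 / 2) ≤ ν) (hx : 0 < x) : 0 < struveMinorant ν x := by
  have h1 := amosFactor_pos (show 0 ≤ ν + 3 / 2 by linarith) hx
  have h2 := tanh_half_pos hx
  unfold struveMinorant
  positivity

theorem hasLogDerivAt_struveMajorant (hν : -(1 / 2) ≤ ν) (hx : 0 < x) :
    HasLogDerivAt (struveMajorant ν) (amosRatio (ν + 1 / 2) x + (ν + 1) / x -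
      x / (3 * (2 * ν + 3) + x ^ 2)) x := by
  have hA : 0 < 2 * ν + 3 := by linarith
  have hA2 : 0 < 3 * (2 * ν + 3) + x ^ 2 := by positivity
  exact ((hasLogDerivAt_amosFactor (by linarith) hx).mul (hasLogDerivAt_rpow _ hx)).div
    (hasLogDerivAt_sqrt_add_sq _ hA2) (Real.sqrt_pos.2 hA2).ne'

theorem hasLogDerivAt_struveMinorant (hν : -(1 / 2) ≤ ν) (hx : 0 < x) :
    HasLogDerivAt (struveMinorant ν) (amosRatio (ν + 3 / 2) x + 1 / Real.sinh x + ν / x) x :=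
  ((hasLogDerivAt_amosFactor (by linarith) hx).mul (hasLogDerivAt_tanh_half hx)).mul
    (hasLogDerivAt_rpow _ hx)

theorem struveMajorant_div_lt {y : ℝ} (hν : -(1 / 2) ≤ ν) (hx : 0 < x) (hxy : x < y) :
    struveMajorant ν x / struveMajorant ν y < modifiedStruveL ν x / modifiedStruveL ν y := by
  refine div_lt_div_of_logDeriv_lt (fun z => struveMajorant_pos hν)
    (fun z => modifiedStruveL_pos (by linarith))
    (fun z => hasLogDerivAt_struveMajorant hν)
    (fun z => hasLogDerivAt_modifiedStruveL (by linarith)) (fun z hz => ?_) hx hxy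
  have h1 := struveRatio_lt_amosRatio hν hz
  have h2 := leadingShare_struve_lt (show -(3 / 2) < ν by linarith) hz
  rw [add_div]
  linarith

theorem div_lt_struveMinorant_div {y : ℝ} (hν : -(1 / 2) ≤ ν) (hx : 0 < x) (hxy : x < y) :
    modifiedStruveL ν x / modifiedStruveL ν y < struveMinorant ν x / struveMinorant ν y := by
  refine div_lt_div_of_logDeriv_lt (fun z => modifiedStruveL_pos (by linarith))
    (fun z => struveMinorant_pos hν)
    (fun z => hasLogDerivAt_modifiedStruveL (by linarith))
    (fun z => hasLogDerivAt_struveMinorant hν) (fun z hz => ?_) hx hxy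
  have h1 := amosRatio_lt_struveRatio hν hz
  have h2 := inv_sinh_le_leadingShare (show 1 ≤ ν + 3 / 2 by linarith) hz
  linarith

theorem amosFactor_div {μ y : ℝ} (hμ : 0 ≤ μ) (hx : 0 < x) (hy : 0 < y) :
    amosFactor μ x / amosFactor μ y =
      Real.exp √(μ ^ 2 + x ^ 2) / Real.exp √(μ ^ 2 + y ^ 2) *
        ((μ + √(μ ^ 2 + y ^ 2)) / (μ + √(μ ^ 2 + x ^ 2))) ^ μ := by
  have h1 := Real.sqrt_pos.2 (show 0 < μ ^ 2 + x ^ 2 by positivity)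
  have h2 := Real.sqrt_pos.2 (show 0 < μ ^ 2 + y ^ 2 by positivity)
  rw [Real.div_rpow (by positivity) (by positivity), amosFactor, amosFactor]
  have h3 : 0 < (μ + √(μ ^ 2 + x ^ 2)) ^ μ := by positivity
  have h4 : 0 < (μ + √(μ ^ 2 + y ^ 2)) ^ μ := by positivity
  field_simp

theorem struveMajorant_div {y : ℝ} (hν : -(1 / 2) ≤ ν) (hx : 0 < x) (hy : 0 < y) :
    struveMajorant ν x / struveMajorant ν y =
      amosFactor (ν + 1 / 2) x / amosFactor (ν + 1 / 2) y * (x / y) ^ (ν + 1) *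
        √((3 * (2 * ν + 3) + y ^ 2) / (3 * (2 * ν + 3) + x ^ 2)) := by
  have h1 := amosFactor_pos (show 0 ≤ ν + 1 / 2 by linarith) hy
  have hA : 0 < 2 * ν + 3 := by linarith
  rw [Real.div_rpow hx.le hy.le, Real.sqrt_div (by positivity), struveMajorant, struveMajorant]
  have h3 : 0 < √(3 * (2 * ν + 3) + x ^ 2) := by positivity
  have h4 : 0 < √(3 * (2 * ν + 3) + y ^ 2) := by positivity
  have h5 : 0 < y ^ (ν + 1) := by positivity
  field_simp

theorem struveMinorant_div {y : ℝ} (hx : 0 < x) (hy : 0 < y) :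
    struveMinorant ν x / struveMinorant ν y =
      amosFactor (ν + 3 / 2) x / amosFactor (ν + 3 / 2) y *
        (Real.tanh (x / 2) / Real.tanh (y / 2)) * (x / y) ^ ν := by
  rw [Real.div_rpow hx.le hy.le, struveMinorant, struveMinorant, mul_div_mul_comm,
    mul_div_mul_comm]

/-! ### Behaviour at the origin -/

theorem continuousAt_amosFactor {μ : ℝ} (hμ : 0 ≤ μ) : ContinuousAt (amosFactor μ) 0 := by
  -- For `μ = 0` the denominator is `0 ^ 0 = 1` at the origin, so it is identically `1`.
  rcases hμ.eq_or_lt with rfl | hμ'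
  · have : amosFactor 0 = fun x => Real.exp √(0 ^ 2 + x ^ 2) := by
      ext x
      simp [amosFactor]
    rw [this]
    fun_prop
  · unfold amosFactor
    refine ContinuousAt.div (by fun_prop) (ContinuousAt.rpow_const (by fun_prop) (.inr hμ)) ?_
    positivity

theorem amosFactor_zero {μ : ℝ} (hμ : 0 ≤ μ) : amosFactor μ 0 = Real.exp μ / (2 * μ) ^ μ := by
  rw [amosFactor, zero_pow two_ne_zero, add_zero, Real.sqrt_sq hμ, two_mul]

theorem amosFactor_zero_pos {μ : ℝ} (hμ : 0 ≤ μ) : 0 < amosFactor μ 0 := by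
  rw [amosFactor_zero hμ]
  rcases hμ.eq_or_lt with rfl | hμ'
  · simp
  · positivity

theorem amosFactor_div_zero {μ : ℝ} (hμ : 0 ≤ μ) (hx : 0 < x) :
    amosFactor μ x / amosFactor μ 0 =
      Real.exp (√(μ ^ 2 + x ^ 2) - μ) * (2 * μ / (μ + √(μ ^ 2 + x ^ 2))) ^ μ := by
  have h1 := Real.sqrt_pos.2 (show 0 < μ ^ 2 + x ^ 2 by positivity)
  rw [amosFactor_zero hμ, amosFactor, Real.div_rpow (by positivity) (by positivity), Real.exp_sub,
    div_div_div_eq]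
  ring

theorem tendsto_gammaSeries_half_sq (hν : -(3 / 2) < ν) :
    Tendsto (fun x : ℝ => gammaSeries (3 / 2) (ν + 3 / 2) (x ^ 2 / 4)) (𝓝[>] 0)
      (𝓝 (1 / (√Real.pi / 2 * Real.Gamma (ν + 3 / 2)))) := by
  have hd : 0 < ν + 3 / 2 := by linarith
  have hc := continuous_gammaSeries (show (0 : ℝ) < 3 / 2 by norm_num) hd
  have h : ContinuousAt (fun x : ℝ => gammaSeries (3 / 2) (ν + 3 / 2) (x ^ 2 / 4)) 0 := by fun_prop
  have h' := h.tendsto.mono_left (nhdsWithin_le_nhds (s := Set.Ioi 0))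
  convert h' using 2
  rw [gammaSeries_eq_zero_add (by norm_num) hd]
  have : Real.Gamma (3 / 2) = √Real.pi / 2 := by
    rw [show (3 : ℝ) / 2 = 1 / 2 + 1 by norm_num, Real.Gamma_add_one (by norm_num),
      Real.Gamma_one_half_eq]
    ring
  simp [this]

theorem tendsto_tanh_half_div : Tendsto (fun x : ℝ => Real.tanh (x / 2) / x) (𝓝[>] 0)
    (𝓝 (1 / 2)) := by
  have h2 : HasDerivAt (fun z : ℝ => z / 2) (1 / 2) 0 := (hasDerivAt_id 0).div_const 2
  have h := (h2.sinh.fun_div h2.cosh (Real.cosh_pos _).ne').tendsto_slope_zero_right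
  simpa [Real.tanh_eq_sinh_div_cosh, div_eq_inv_mul] using h

theorem tendsto_struveMajorant_div (hν : -(1 / 2) ≤ ν) :
    Tendsto (fun x => struveMajorant ν x / modifiedStruveL ν x) (𝓝[>] 0)
      (𝓝 (amosFactor (ν + 1 / 2) 0 / √(3 * (2 * ν + 3)) *
        (√Real.pi * 2 ^ ν * Real.Gamma (ν + 3 / 2)))) := by
  have hμ : 0 ≤ ν + 1 / 2 := by linarith
  have hd : 0 < ν + 3 / 2 := by linarith
  have hA : 0 < 3 * (2 * ν + 3) := by linarith
  have hG := Real.Gamma_pos_of_pos hd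
  have hpi := Real.sqrt_pos.2 Real.pi_pos
  have h1 := (continuousAt_amosFactor hμ).tendsto.mono_left (nhdsWithin_le_nhds (s := Set.Ioi 0))
  have hs : Continuous fun x : ℝ => √(3 * (2 * ν + 3) + x ^ 2) := by fun_prop
  have h2 := hs.continuousAt.tendsto.mono_left (nhdsWithin_le_nhds (a := 0) (s := Set.Ioi 0))
  rw [zero_pow two_ne_zero, add_zero] at h2
  have h3 := tendsto_gammaSeries_half_sq (show -(3 / 2) < ν by linarith)
  have h := ((h1.div h2 (Real.sqrt_pos.2 hA).ne').div h3 (by positivity)).mul_const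
    ((2 : ℝ) ^ (ν + 1))
  have e : amosFactor (ν + 1 / 2) 0 / √(3 * (2 * ν + 3)) *
        (√Real.pi * 2 ^ ν * Real.Gamma (ν + 3 / 2)) =
      amosFactor (ν + 1 / 2) 0 / √(3 * (2 * ν + 3)) /
        (1 / (√Real.pi / 2 * Real.Gamma (ν + 3 / 2))) * 2 ^ (ν + 1) := by
    rw [Real.rpow_add_one two_ne_zero, div_div_eq_mul_div]
    ring
  rw [e]
  refine h.congr' ?_
  filter_upwards [self_mem_nhdsWithin] with x hx
  have hx : 0 < x := hx
  have h4 := gammaSeries_pos (show (0 : ℝ) < 3 / 2 by norm_num) hd (show 0 ≤ x ^ 2 / 4 by positivity)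
  have h5 : 0 < x ^ (ν + 1) := by positivity
  rw [modifiedStruveL_eq hx, struveMajorant, Real.div_rpow hx.le two_pos.le]
  simp only [Pi.div_apply]
  field_simp

theorem tendsto_div_struveMinorant (hν : -(1 / 2) ≤ ν) :
    Tendsto (fun x => modifiedStruveL ν x / struveMinorant ν x) (𝓝[>] 0)
      (𝓝 (1 / (amosFactor (ν + 3 / 2) 0 *
        (√Real.pi * 2 ^ (ν - 1) * Real.Gamma (ν + 3 / 2))))) := by
  have hd : 0 < ν + 3 / 2 := by linarith
  have hG := Real.Gamma_pos_of_pos hd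
  have hpi := Real.sqrt_pos.2 Real.pi_pos
  have h1 := (continuousAt_amosFactor hd.le).tendsto.mono_left
    (nhdsWithin_le_nhds (s := Set.Ioi 0))
  have h0 := amosFactor_zero_pos hd.le
  have h3 := tendsto_gammaSeries_half_sq (show -(3 / 2) < ν by linarith)
  have h := (h3.div (h1.mul tendsto_tanh_half_div) (by positivity)).div_const ((2 : ℝ) ^ (ν + 1))
  have e : 1 / (amosFactor (ν + 3 / 2) 0 *
        (√Real.pi * 2 ^ (ν - 1) * Real.Gamma (ν + 3 / 2))) =
      1 / (√Real.pi / 2 * Real.Gamma (ν + 3 / 2)) / (amosFactor (ν + 3 / 2) 0 * (1 / 2)) /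
        2 ^ (ν + 1) := by
    rw [Real.rpow_add_one two_ne_zero, Real.rpow_sub_one two_ne_zero]
    field_simp
  rw [e]
  refine h.congr' ?_
  filter_upwards [self_mem_nhdsWithin] with x hx
  have hx : 0 < x := hx
  have h4 := tanh_half_pos hx
  have h5 : 0 < x ^ ν := by positivity
  have h6 := amosFactor_pos hd.le hx
  rw [modifiedStruveL_eq hx, struveMinorant, Real.div_rpow hx.le two_pos.le,
    Real.rpow_add_one hx.ne']
  simp only [Pi.div_apply]
  field_simp

end

/-! ### The inequalities -/

theorem mainTheorem3 :
    -- (i), lower bound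
    (∀ ν x y : ℝ, -(1 / 2) ≤ ν → 0 < x → x < y →
      x / y * Real.sqrt ((3 * (2 * ν + 3) + y ^ 2) / (3 * (2 * ν + 3) + x ^ 2)) *
          (modifiedBesselI ν x / modifiedBesselI ν y)
        < modifiedStruveL ν x / modifiedStruveL ν y) ∧
    -- (i), upper bound
    (∀ ν x y : ℝ, 1 / 2 ≤ ν → 0 < x → x < y →
      modifiedStruveL ν x / modifiedStruveL ν y < modifiedBesselI ν x / modifiedBesselI ν y) ∧
    -- (ii)
    (∀ ν x y : ℝ, -(1 / 2) ≤ ν → 0 < x → x < y →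
      Real.exp (Real.sqrt ((ν + 1 / 2) ^ 2 + x ^ 2)) /
            Real.exp (Real.sqrt ((ν + 1 / 2) ^ 2 + y ^ 2)) *
          (x / y) ^ (ν + 1) *
          Real.sqrt ((3 * (2 * ν + 3) + y ^ 2) / (3 * (2 * ν + 3) + x ^ 2)) *
          ((ν + 1 / 2 + Real.sqrt ((ν + 1 / 2) ^ 2 + y ^ 2)) /
            (ν + 1 / 2 + Real.sqrt ((ν + 1 / 2) ^ 2 + x ^ 2))) ^ (ν + 1 / 2)
        < modifiedStruveL ν x / modifiedStruveL ν y ∧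
      modifiedStruveL ν x / modifiedStruveL ν y
        < Real.exp (Real.sqrt ((ν + 3 / 2) ^ 2 + x ^ 2)) /
            Real.exp (Real.sqrt ((ν + 3 / 2) ^ 2 + y ^ 2)) *
          (Real.tanh (x / 2) / Real.tanh (y / 2)) *
          (x / y) ^ ν *
          ((ν + 3 / 2 + Real.sqrt ((ν + 3 / 2) ^ 2 + y ^ 2)) /
            (ν + 3 / 2 + Real.sqrt ((ν + 3 / 2) ^ 2 + x ^ 2))) ^ (ν + 3 / 2)) ∧
    -- (iii)
    (∀ ν x : ℝ, -(1 / 2) ≤ ν → 0 < x →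
      Real.exp (Real.sqrt ((ν + 3 / 2) ^ 2 + x ^ 2) - ν - 3 / 2) /
            (Real.sqrt Real.pi * (2 : ℝ) ^ (ν - 1) * Real.Gamma (ν + 3 / 2)) *
          x ^ ν * Real.tanh (x / 2) *
          ((2 * ν + 3) / (ν + 3 / 2 + Real.sqrt ((ν + 3 / 2) ^ 2 + x ^ 2))) ^ (ν + 3 / 2)
        < modifiedStruveL ν x ∧
      modifiedStruveL ν x
        < Real.exp (Real.sqrt ((ν + 1 / 2) ^ 2 + x ^ 2) - ν - 1 / 2) /
            (Real.sqrt Real.pi * (2 : ℝ) ^ ν * Real.Gamma (ν + 3 / 2)) *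
          x ^ (ν + 1) *
          Real.sqrt (3 * (2 * ν + 3) / (3 * (2 * ν + 3) + x ^ 2)) *
          ((2 * ν + 1) / (ν + 1 / 2 + Real.sqrt ((ν + 1 / 2) ^ 2 + x ^ 2))) ^ (ν + 1 / 2)) := by
  refine ⟨fun ν x y hν hx hxy => ?_, fun ν x y hν hx hxy => ?_, fun ν x y hν hx hxy => ⟨?_, ?_⟩,
    fun ν x hν hx => ⟨?_, ?_⟩⟩
  · have hy := hx.trans hxy
    have hA : 0 < 2 * ν + 3 := by linarith
    have hs : ∀ z : ℝ, 0 < 3 * (2 * ν + 3) + z ^ 2 := fun z => by positivity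
    have hI : ∀ z, 0 < z → 0 < modifiedBesselI ν z := fun z => modifiedBesselI_pos (by linarith)
    -- Compare `L_ν` with `x I_ν(x) / √(3 (2ν + 3) + x²)`.
    have h := div_lt_div_of_logDeriv_lt
      (f := fun z => z ^ (1 : ℝ) * modifiedBesselI ν z / √(3 * (2 * ν + 3) + z ^ 2))
      (fun z hz => div_pos (mul_pos (by positivity) (hI z hz)) (Real.sqrt_pos.2 (hs z)))
      (fun z => modifiedStruveL_pos (show -(3 / 2) < ν by linarith))
      (fun z hz => ((hasLogDerivAt_rpow 1 hz).mul
        (hasLogDerivAt_modifiedBesselI (by linarith) hz)).div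
          (hasLogDerivAt_sqrt_add_sq _ (hs z)) (Real.sqrt_pos.2 (hs z)).ne')
      (fun z => hasLogDerivAt_modifiedStruveL (by linarith))
      (fun z hz => by
        have h1 := struveRatio_lt_besselRatio hν hz
        have h2 := leadingShare_struve_lt (show -(3 / 2) < ν by linarith) hz
        linarith) hx hxy
    refine lt_of_eq_of_lt ?_ h
    have h1 := Real.sqrt_pos.2 (hs x)
    have h2 := Real.sqrt_pos.2 (hs y)
    have h3 := hI y hy
    rw [Real.sqrt_div (hs y).le, Real.rpow_one, Real.rpow_one]
    field_simp
  · refine div_lt_div_of_logDeriv_lt (fun z => modifiedStruveL_pos (by linarith))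
      (fun z => modifiedBesselI_pos (by linarith))
      (fun z => hasLogDerivAt_modifiedStruveL_of_lower (by linarith))
      (fun z => hasLogDerivAt_modifiedBesselI_of_lower (by linarith)) (fun z hz => ?_) hx hxy
    -- The logarithmic derivatives involve `L_{ν-1} / L_ν` and `I_{ν-1} / I_ν`, so the comparison
    -- of ratios is used at order `ν - 1`.
    have h := struveRatio_lt_besselRatio (show -(1 / 2) ≤ ν - 1 by linarith) hz
    rw [show ν - 1 + 3 / 2 = ν + 1 / 2 by ring, sub_add_cancel] at h
    have h1 := one_div_lt_one_div_of_lt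
      (seriesRatio_pos (by norm_num) (show 0 < ν + 1 / 2 by linarith) hz) h
    linarith
  · have hy := hx.trans hxy
    refine lt_of_eq_of_lt ?_ (struveMajorant_div_lt hν hx hxy)
    rw [struveMajorant_div hν hx hy, amosFactor_div (by linarith) hx hy]
    ring
  · have hy := hx.trans hxy
    refine (div_lt_struveMinorant_div hν hx hxy).trans_eq ?_
    rw [struveMinorant_div hx hy, amosFactor_div (by linarith) hx hy]
    ring
  · have h := mul_lt_of_div_lt_div (fun z => modifiedStruveL_pos (by linarith))
      (fun z => struveMinorant_pos hν) (fun x y => div_lt_struveMinorant_div hν)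
      (tendsto_div_struveMinorant hν) hx
    refine lt_of_eq_of_lt ?_ h
    have e := amosFactor_div_zero (show 0 ≤ ν + 3 / 2 by linarith) hx
    rw [show 2 * (ν + 3 / 2) = 2 * ν + 3 by ring, ← sub_sub] at e
    calc _ = amosFactor (ν + 3 / 2) x / amosFactor (ν + 3 / 2) 0 /
          (√Real.pi * 2 ^ (ν - 1) * Real.Gamma (ν + 3 / 2)) * x ^ ν * Real.tanh (x / 2) := by
          rw [e]
          ring
      _ = _ := by
          rw [struveMinorant]
          ring
  · have h := mul_lt_of_div_lt_div (fun z => struveMajorant_pos hν)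
      (fun z => modifiedStruveL_pos (by linarith)) (fun x y => struveMajorant_div_lt hν)
      (tendsto_struveMajorant_div hν) hx
    have hA : 0 < 2 * ν + 3 := by linarith
    have h0 := amosFactor_zero_pos (show 0 ≤ ν + 1 / 2 by linarith)
    have hG := Real.Gamma_pos_of_pos (show 0 < ν + 3 / 2 by linarith)
    have hpi := Real.sqrt_pos.2 Real.pi_pos
    rw [← lt_div_iff₀' (by positivity)] at h
    refine h.trans_eq ?_
    have e := amosFactor_div_zero (show 0 ≤ ν + 1 / 2 by linarith) hx
    rw [show 2 * (ν + 1 / 2) = 2 * ν + 1 by ring, ← sub_sub] at e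
    calc _ = amosFactor (ν + 1 / 2) x / amosFactor (ν + 1 / 2) 0 /
          (√Real.pi * 2 ^ ν * Real.Gamma (ν + 3 / 2)) * x ^ (ν + 1) *
            √(3 * (2 * ν + 3) / (3 * (2 * ν + 3) + x ^ 2)) := by
          rw [struveMajorant, Real.sqrt_div (by positivity)]
          field_simp
      _ = _ := by
          rw [e]
          ring
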